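/- Let $(M,\omega)$ be a symplectic manifold, i.e. a finite-dimensional smooth real manifold $M$ with a smooth $2$-form $\omega$ that is closed ($d\omega=0$) and non-degenerate at every point. For $f\in C^\infty(M)$ let $v_f\in\mathfrak X(M)$ be the Hamiltonian vector field of $f$, the unique smooth vector field with $\iota_{v_f}\omega=-df$, where $\iota_{v}\omega=\omega(v,\cdot)$; and for $f,g\in C^\infty(M)$ let $\{f,g\}=\omega(v_f,v_g)\in C^\infty(M)$ be the Poisson bracket. Then: 1. The Poisson bracket makes the real vector space $C^\infty(M)$ a Lie algebra: it is $\mathbb R$-bilinear, antisymmetric ($\{f,g\}=-\{g,f\}$, $\{f,f\}=0$), and satisfies the Jacobi identity $\{f,\{g,h\}\}+\{g,\{h,f\}\}+\{h,\{f,g\}\}=0$. 2. The map $C^\infty(M)\to\mathfrak X(M)$, $f\mapsto v_f$, is a homomorphism of Lie algebras, where $\mathfrak X(M)$ carries the usual Lie bracket of vector fields: it is $\mathbb R$-linear and $v_{\{f,g\}}=[v_f,v_g]$ for all $f,g\in C^\infty(M)$. 3. The kernel of this map is the space of locally constant functions on $M$, and its image is the space $\mathfrak X_{\mathrm{Ham}}(M)$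 of Hamiltonian vector fields, i.e. of the $v\in\mathfrak X(M)$ such that $\iota_v\omega=-df$ for some $f\in C^\infty(M)$. -/

import Mathlib

open scoped Manifold ContDiff
open Bundle

noncomputable section

namespace SymplecticGeometry

section Basic

variable (E : Type*) [NormedAddCommGroup E] [NormedSpace ℝ E]
  (M : Type*) [TopologicalSpace M] [ChartedSpace E M]

/-- The algebra `C^∞(M)` of smooth real-valued functions on a manifold `M` modelled on `E`. -/
abbrev SmoothFunction := C^∞⟮𝓘(ℝ, E), M; ℝ⟯

variable [IsManifold 𝓘(ℝ, E) ∞ M]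

/-- The space `𝔛(M)` of smooth vector fields, i.e. smooth sections of the tangent bundle. -/
abbrev SmoothVectorField :=
  Cₛ^∞⟮𝓘(ℝ, E); E, (TangentSpace 𝓘(ℝ, E) : M → Type _)⟯

/-- The space `Ω^k(M)` of smooth differential `k`-forms, i.e. smooth sections of the bundle whose
fibre at `x` is the space of alternating `k`-linear forms on the tangent space at `x`. -/
abbrev DifferentialForm (k : ℕ) :=
  Cₛ^∞⟮𝓘(ℝ, E); E [⋀^Fin k]→L[ℝ] ℝ,
    (fun x : M ↦ TangentSpace 𝓘(ℝ, E) x [⋀^Fin k]→L[ℝ] Trivial M ℝ x)⟯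

end Basic

section Forms

variable {E : Type*} [NormedAddCommGroup E] [NormedSpace ℝ E]
  {M : Type*} [TopologicalSpace M] [ChartedSpace E M]

/-- The differential `df` at `x`, a linear form on the tangent space at `x`. -/
def differential (f : SmoothFunction E M) (x : M) : TangentSpace 𝓘(ℝ, E) x →L[ℝ] ℝ :=
  mfderiv 𝓘(ℝ, E) 𝓘(ℝ, ℝ) f x

variable [IsManifold 𝓘(ℝ, E) ∞ M]

/-- The expression of a form in the chart around `x₀`: the pullback of the form by the inverse
of the chart. Only its values on the (open) target of the chart are meaningful. -/
def DifferentialForm.inChart {k : ℕ} (α : DifferentialForm E M k) (x₀ : M) (y : E) :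
    E [⋀^Fin k]→L[ℝ] ℝ :=
  ContinuousAlternatingMap.compContinuousLinearMap (M' := E)
    (α ((extChartAt 𝓘(ℝ, E) x₀).symm y))
    (mfderiv 𝓘(ℝ, E) 𝓘(ℝ, E) (extChartAt 𝓘(ℝ, E) x₀).symm y)

/-- The exterior derivative `dα` at `x`: write `α` in the chart around `x`, take the exterior
derivative in the vector space `E`, and pull the result back to the tangent space at `x`. -/
def DifferentialForm.extDerivAt {k : ℕ} (α : DifferentialForm E M k) (x : M) :
    TangentSpace 𝓘(ℝ, E) x [⋀^Fin (k + 1)]→L[ℝ] ℝ :=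
  ContinuousAlternatingMap.compContinuousLinearMap (M' := E)
    (extDeriv (α.inChart x) (extChartAt 𝓘(ℝ, E) x x))
    (mfderiv 𝓘(ℝ, E) 𝓘(ℝ, E) (extChartAt 𝓘(ℝ, E) x) x)

/-- The value `α(v, w)` of a `2`-form on two tangent vectors at `x`. -/
def DifferentialForm.eval₂ (α : DifferentialForm E M 2) (x : M)
    (v w : TangentSpace 𝓘(ℝ, E) x) : ℝ :=
  α x ![v, w]

/-! Auxiliary facts: smoothness can be checked in the trivialization of the tangent bundle. -/

/-- The form `α x` read in the trivialization of the tangent bundle around `x₀`. -/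
def coordForm {k : ℕ} (α : DifferentialForm E M k) (x₀ x : M) : E [⋀^Fin k]→L[ℝ] ℝ :=
  ContinuousAlternatingMap.compContinuousLinearMap (M' := TangentSpace 𝓘(ℝ, E) x) (α x)
    ((trivializationAt E (TangentSpace 𝓘(ℝ, E)) x₀).symmL ℝ x)

/-- The covector `df` at `x` read in the trivialization of the tangent bundle around `x₀`. -/
def coordDiff (f : SmoothFunction E M) (x₀ x : M) : E →L[ℝ] ℝ :=
  ContinuousLinearMap.comp (M₂ := TangentSpace 𝓘(ℝ, E) x) (differential f x)
    ((trivializationAt E (TangentSpace 𝓘(ℝ, E)) x₀).symmL ℝ x)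

theorem coordForm_apply_two (α : DifferentialForm E M 2) (x₀ x : M) (v w : E) :
    coordForm α x₀ x ![v, w] =
      α.eval₂ x ((trivializationAt E (TangentSpace 𝓘(ℝ, E)) x₀).symmL ℝ x v)
        ((trivializationAt E (TangentSpace 𝓘(ℝ, E)) x₀).symmL ℝ x w) := by
  change α x _ = α x _
  congr 1
  funext i
  fin_cases i <;> rfl

theorem contMDiffAt_coordForm {k : ℕ} (α : DifferentialForm E M k) (x₀ : M) :
    ContMDiffAt 𝓘(ℝ, E) 𝓘(ℝ, E [⋀^Fin k]→L[ℝ] ℝ) ∞ (coordForm α x₀) x₀ := by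
  have h := (contMDiffAt_section x₀).1 (α.contMDiff x₀)
  convert! h using 1
  ext x : 1
  rw [FiberBundle.trivializationAt_continuousAlternatingMap_apply]
  ext v
  simp [coordForm, ContinuousAlternatingMap.inCoordinates]
  rfl

theorem contMDiffAt_curry_coordForm (α : DifferentialForm E M 2) (x₀ : M) :
    ContMDiffAt 𝓘(ℝ, E) 𝓘(ℝ, E →L[ℝ] (E [⋀^Fin 1]→L[ℝ] ℝ)) ∞
      (fun x ↦ (coordForm α x₀ x).curryLeft) x₀ := by
  have hC : ContDiff ℝ ∞
      (fun a : E [⋀^Fin 2]→L[ℝ] ℝ ↦ (a.curryLeft : E →L[ℝ] (E [⋀^Fin 1]→L[ℝ] ℝ))) := by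
    apply IsBoundedLinearMap.contDiff
    refine { map_add := fun _ _ ↦ rfl, map_smul := fun _ _ ↦ rfl, bound := ⟨1, one_pos, fun a ↦ ?_⟩ }
    simp
  exact hC.contMDiff.contMDiffAt.comp x₀ (contMDiffAt_coordForm α x₀)

theorem contMDiffAt_coordDiff (f : SmoothFunction E M) (x₀ : M) :
    ContMDiffAt 𝓘(ℝ, E) 𝓘(ℝ, E →L[ℝ] ℝ) ∞ (coordDiff f x₀) x₀ := by
  have : IsManifold 𝓘(ℝ, E) 1 M := IsManifold.of_le (n := ∞) (by simp)
  have h := (f.contMDiff x₀).mfderiv_const (m := ∞) (by simp)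
  convert! h using 1
  ext x v
  simp only [inTangentCoordinates, ContinuousLinearMap.inCoordinates,
    TangentBundle.continuousLinearMapAt_model_space]
  rfl

theorem symmL_trivialization_apply (x₀ x : M)
    (hx : x ∈ (trivializationAt E (TangentSpace 𝓘(ℝ, E) : M → Type _) x₀).baseSet)
    (v : TangentSpace 𝓘(ℝ, E) x) :
    (trivializationAt E (TangentSpace 𝓘(ℝ, E)) x₀).symmL ℝ x
      (trivializationAt E (TangentSpace 𝓘(ℝ, E)) x₀ ⟨x, v⟩).2 = v := by
  rw [← Trivialization.continuousLinearMapAt_apply_of_mem (R := ℝ) _ hx,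
    Trivialization.symmL_continuousLinearMapAt _ hx]

/-- The smooth function `x ↦ α(X(x), Y(x))`, for a `2`-form `α` and vector fields `X`, `Y`. -/
def DifferentialForm.evalFields (α : DifferentialForm E M 2) (X Y : SmoothVectorField E M) :
    SmoothFunction E M :=
  ⟨fun x ↦ α.eval₂ x (X x) (Y x), by
    intro x₀
    set e := trivializationAt E (TangentSpace 𝓘(ℝ, E) : M → Type _) x₀ with he
    have hx₀ : x₀ ∈ e.baseSet := FiberBundle.mem_baseSet_trivializationAt' x₀
    have hX := (contMDiffAt_section x₀).1 (X.contMDiff x₀)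
    have hY := (contMDiffAt_section x₀).1 (Y.contMDiff x₀)
    let L := ContinuousAlternatingMap.ofSubsingletonLIE (𝕜 := ℝ) (E := E) (F := ℝ) (0 : Fin 1)
    have h2 := (L.symm.toContinuousLinearEquiv.toContinuousLinearMap.contMDiff.contMDiffAt
      (n := ∞)).comp x₀ ((contMDiffAt_curry_coordForm α x₀).clm_apply hX)
    refine (h2.clm_apply hY).congr_of_eventuallyEq ?_
    filter_upwards [e.open_baseSet.mem_nhds hx₀] with x hx
    have h4 := coordForm_apply_two α x₀ x (e ⟨x, X x⟩).2 (e ⟨x, Y x⟩).2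
    rw [he, symmL_trivialization_apply x₀ x hx, symmL_trivialization_apply x₀ x hx] at h4
    refine h4.symm.trans ?_
    change coordForm α x₀ x _ = coordForm α x₀ x _
    congr 1
    funext i
    fin_cases i <;> rfl⟩

end Forms

section Symplectic

variable (E : Type*) [NormedAddCommGroup E] [NormedSpace ℝ E]
  (M : Type*) [TopologicalSpace M] [ChartedSpace E M] [IsManifold 𝓘(ℝ, E) ∞ M]

/-- A symplectic form on `M`: a smooth closed `2`-form which is nondegenerate at every point. -/
structure SymplecticForm where
  form : DifferentialForm E M 2
  closed : ∀ x : M, form.extDerivAt x = 0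
  nondegenerate : ∀ (x : M) (v : TangentSpace 𝓘(ℝ, E) x),
    (∀ w : TangentSpace 𝓘(ℝ, E) x, form.eval₂ x v w = 0) → v = 0

end Symplectic

section Hamiltonian

variable {E : Type*} [NormedAddCommGroup E] [NormedSpace ℝ E]
  {M : Type*} [TopologicalSpace M] [ChartedSpace E M] [IsManifold 𝓘(ℝ, E) ∞ M]

/-- `V` is the Hamiltonian vector field of `f`, i.e. `ι_V σ = -df`. -/
def IsHamiltonianFieldOf (σ : SymplecticForm E M) (f : SmoothFunction E M)
    (V : SmoothVectorField E M) : Prop :=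
  ∀ (x : M) (w : TangentSpace 𝓘(ℝ, E) x), σ.form.eval₂ x (V x) w = -differential f x w

theorem exists_flatEquiv [FiniteDimensional ℝ E] (a : E [⋀^Fin 2]→L[ℝ] ℝ)
    (ha : ∀ v : E, (∀ w : E, a ![v, w] = 0) → v = 0) :
    ∃ Φ : E ≃L[ℝ] (E [⋀^Fin 1]→L[ℝ] ℝ),
      (Φ : E →L[ℝ] (E [⋀^Fin 1]→L[ℝ] ℝ)) = a.curryLeft := by
  let L := ContinuousAlternatingMap.ofSubsingletonLIE (𝕜 := ℝ) (E := E) (F := ℝ) (0 : Fin 1)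
  have : FiniteDimensional ℝ (E [⋀^Fin 1]→L[ℝ] ℝ) := L.toLinearEquiv.finiteDimensional
  have hinj : Function.Injective (a.curryLeft : E →ₗ[ℝ] (E [⋀^Fin 1]→L[ℝ] ℝ)) := by
    rw [injective_iff_map_eq_zero]
    intro v hv
    apply ha v
    intro w
    have := congrArg (fun b : E [⋀^Fin 1]→L[ℝ] ℝ ↦ b ![w]) hv
    simpa using this
  have hdim : Module.finrank ℝ E = Module.finrank ℝ (E [⋀^Fin 1]→L[ℝ] ℝ) := by
    rw [← L.toLinearEquiv.finrank_eq,
      ← (LinearMap.toContinuousLinearMap (𝕜 := ℝ) (E := E) (F' := ℝ)).finrank_eq]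
    exact (Subspace.dual_finrank_eq (K := ℝ) (V := E)).symm
  let e := LinearMap.linearEquivOfInjective _ hinj hdim
  refine ⟨e.toContinuousLinearEquiv, ?_⟩
  ext v : 1
  rfl

/-- Every smooth function has a smooth Hamiltonian vector field. -/
theorem exists_hamiltonianVectorField [FiniteDimensional ℝ E] (σ : SymplecticForm E M)
    (f : SmoothFunction E M) : ∃ V : SmoothVectorField E M, IsHamiltonianFieldOf σ f V := by
  let L := ContinuousAlternatingMap.ofSubsingletonLIE (𝕜 := ℝ) (E := E) (F := ℝ) (0 : Fin 1)
  have hV : ∀ x : M, ∃ v : TangentSpace 𝓘(ℝ, E) x, ∀ w : TangentSpace 𝓘(ℝ, E) x,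
      σ.form.eval₂ x v w = -differential f x w := by
    intro x
    obtain ⟨Φ, hΦ⟩ := exists_flatEquiv (E := E) (σ.form x) (σ.nondegenerate x)
    refine ⟨Φ.symm (L (-differential f x)), fun w ↦ ?_⟩
    have h := congrArg (fun T : E →L[ℝ] (E [⋀^Fin 1]→L[ℝ] ℝ) ↦
      T (Φ.symm (L (-differential f x))) ![w]) hΦ
    simp only [ContinuousLinearEquiv.coe_coe, ContinuousLinearEquiv.apply_symm_apply] at h
    exact h.symm
  choose V hV using hV
  refine ⟨⟨V, fun x₀ ↦ (contMDiffAt_section x₀).2 ?_⟩, hV⟩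
  set e := trivializationAt E (TangentSpace 𝓘(ℝ, E) : M → Type _) x₀ with he
  have hx₀ : x₀ ∈ e.baseSet := FiberBundle.mem_baseSet_trivializationAt' x₀
  have key : ∀ x ∈ e.baseSet, (e ⟨x, V x⟩).2 =
      (coordForm σ.form x₀ x).curryLeft.inverse (L (-coordDiff f x₀ x)) ∧
        (coordForm σ.form x₀ x).curryLeft.IsInvertible := by
    intro x hx
    have hnd : ∀ v : E, (∀ w : E, coordForm σ.form x₀ x ![v, w] = 0) → v = 0 := by
      intro v hv
      have h0 : e.symmL ℝ x v = 0 := by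
        apply σ.nondegenerate x
        intro w
        rw [← hv (e.continuousLinearMapAt ℝ x w), coordForm_apply_two,
          e.symmL_continuousLinearMapAt hx w]
      have := congrArg (e.continuousLinearMapAt ℝ x) h0
      rwa [e.continuousLinearMapAt_symmL hx, map_zero] at this
    obtain ⟨Φ, hΦ⟩ := exists_flatEquiv _ hnd
    refine ⟨?_, ⟨Φ, hΦ⟩⟩
    rw [← hΦ, ContinuousLinearMap.inverse_equiv, ContinuousLinearEquiv.coe_coe,
      ContinuousLinearEquiv.eq_symm_apply, ← ContinuousLinearEquiv.coe_coe, hΦ]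
    ext w
    have hw : w = ![w 0] := by
      funext i
      fin_cases i
      rfl
    rw [hw]
    change coordForm σ.form x₀ x ![(e ⟨x, V x⟩).2, w 0] =
      -differential f x (e.symmL ℝ x (w 0))
    rw [coordForm_apply_two, ← hV x, symmL_trivialization_apply x₀ x hx]
  have h2 : ContMDiffAt 𝓘(ℝ, E) 𝓘(ℝ, E [⋀^Fin 1]→L[ℝ] ℝ) ∞
      (fun x ↦ L (-coordDiff f x₀ x)) x₀ :=
    (L.toContinuousLinearEquiv.toContinuousLinearMap.contMDiff.contMDiffAt (n := ∞)).comp x₀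
      (contMDiffAt_coordDiff f x₀).neg
  have : CompleteSpace E := FiniteDimensional.complete ℝ E
  have h3 : ContMDiffAt 𝓘(ℝ, E) 𝓘(ℝ, (E [⋀^Fin 1]→L[ℝ] ℝ) →L[ℝ] E) ∞
      (fun x ↦ (coordForm σ.form x₀ x).curryLeft.inverse) x₀ :=
    ContMDiffAt.comp (I' := 𝓘(ℝ, E →L[ℝ] (E [⋀^Fin 1]→L[ℝ] ℝ))) x₀
      (g := ContinuousLinearMap.inverse)
      (ContinuousLinearMap.IsInvertible.contDiffAt_map_inverse (key x₀ hx₀).2).contMDiffAt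
      (contMDiffAt_curry_coordForm σ.form x₀)
  refine (h3.clm_apply h2).congr_of_eventuallyEq ?_
  filter_upwards [e.open_baseSet.mem_nhds hx₀] with x hx
  exact (key x hx).1

/-- The Hamiltonian vector field `v_f` of `f`: the smooth vector field with `ι_{v_f} σ = -df`. -/
def hamiltonianVectorField [FiniteDimensional ℝ E] (σ : SymplecticForm E M)
    (f : SmoothFunction E M) : SmoothVectorField E M :=
  (exists_hamiltonianVectorField σ f).choose

theorem isHamiltonianFieldOf_hamiltonianVectorField [FiniteDimensional ℝ E]
    (σ : SymplecticForm E M) (f : SmoothFunction E M) :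
    IsHamiltonianFieldOf σ f (hamiltonianVectorField σ f) :=
  (exists_hamiltonianVectorField σ f).choose_spec

/-- The Hamiltonian vector field of a function is unique. -/
theorem IsHamiltonianFieldOf.unique {σ : SymplecticForm E M} {f : SmoothFunction E M}
    {V W : SmoothVectorField E M} (hV : IsHamiltonianFieldOf σ f V)
    (hW : IsHamiltonianFieldOf σ f W) : V = W := by
  ext x
  have h : (V x - W x : TangentSpace 𝓘(ℝ, E) x) = 0 := by
    apply σ.nondegenerate x
    intro w
    have key : ∀ a b : TangentSpace 𝓘(ℝ, E) x,
        σ.form.eval₂ x (a - b) w = σ.form.eval₂ x a w - σ.form.eval₂ x b w := fun a b ↦ by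
      simp [DifferentialForm.eval₂]
    rw [key, hV x w, hW x w, sub_self]
  exact sub_eq_zero.1 h

/-- The Poisson bracket `{f, g} = σ(v_f, v_g)`. -/
def poissonBracket [FiniteDimensional ℝ E] (σ : SymplecticForm E M)
    (f g : SmoothFunction E M) : SmoothFunction E M :=
  σ.form.evalFields (hamiltonianVectorField σ f) (hamiltonianVectorField σ g)

/-- The usual Lie bracket `[X, Y]` of smooth vector fields. -/
def vectorFieldBracket [FiniteDimensional ℝ E] (X Y : SmoothVectorField E M) :
    SmoothVectorField E M :=
  ⟨VectorField.mlieBracket 𝓘(ℝ, E) X Y, by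
    have : CompleteSpace E := FiniteDimensional.complete ℝ E
    have : IsManifold 𝓘(ℝ, E) (∞ + 1) M := by simpa using ‹IsManifold 𝓘(ℝ, E) ∞ M›
    have : IsManifold 𝓘(ℝ, E) (minSmoothness ℝ 2) M :=
      IsManifold.of_le (n := ∞) (by
        rw [minSmoothness_of_isRCLikeNormedField]
        exact ENat.LEInfty.out)
    exact ContDiff.mlieBracket_vectorField X.contMDiff Y.contMDiff (by simp)⟩

end Hamiltonian

/-- `b` is a Lie bracket on the `R`-module `L`, i.e. it makes `L` a Lie algebra over `R`. -/
structure IsLieBracket (R : Type*) {L : Type*} [CommRing R] [AddCommGroup L] [Module R L]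
    (b : L → L → L) : Prop where
  add_left : ∀ x y z, b (x + y) z = b x z + b y z
  smul_left : ∀ (c : R) (x y), b (c • x) y = c • b x y
  add_right : ∀ x y z, b x (y + z) = b x y + b x z
  smul_right : ∀ (c : R) (x y), b x (c • y) = c • b x y
  self_eq_zero : ∀ x, b x x = 0
  antisymm : ∀ x y, b x y = -b y x
  jacobi : ∀ x y z, b x (b y z) + b y (b z x) + b z (b x y) = 0

end SymplecticGeometry

end

noncomputable section

namespace SymplecticGeometry

open Filter Set VectorField
open scoped Topology

/-! ### Calculus of 2-forms on a vector space. -/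

section VectorSpace

variable {E : Type*} [NormedAddCommGroup E] [NormedSpace ℝ E]

/-! The heart is the identity `ι_{[X,Y]} ω = -d(ω(X,Y))` for Hamiltonian fields `X`, `Y` of `f`,
`g`. It is proved in a chart (`closed_two_form_apply_lieBracket`): differentiating `ω(X,·) = -df`
and `ω(Y,·) = -dg` expresses the derivatives of `X` and `Y` through second derivatives of `f`, `g`
and first derivatives of `ω`. The former cancel by symmetry, and what remains is `dω(X,Y,·) = 0`.
Nondegeneracy makes Hamiltonian fields unique, so `v_{f,g} = [v_f,v_g]`.

The Jacobi identity then needs no further computation. Since `{f,g} = dg(v_f)`, the field `v_f` acts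
on functions as `{f,·}`; the bracket of fields acts as the commutator, so `{{f,g},h} = {f,{g,h}} -
{g,{f,h}}`.

Linearity and the description of the image follow from uniqueness. For the kernel, `v_f = 0` iff `df
= 0` by nondegeneracy, and `df = 0` iff `f` is locally constant. -/

theorem alternating_two_add_left (a : E [⋀^Fin 2]→L[ℝ] ℝ) (u v w : E) :
    a ![u + v, w] = a ![u, w] + a ![v, w] :=
  a.vecCons_add ![w] u v

theorem alternating_two_smul_left (a : E [⋀^Fin 2]→L[ℝ] ℝ) (c : ℝ) (v w : E) :
    a ![c • v, w] = c * a ![v, w] :=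
  a.vecCons_smul ![w] c v

theorem alternating_two_swap (a : E [⋀^Fin 2]→L[ℝ] ℝ) (v w : E) : a ![v, w] = -a ![w, v] := by
  have h := a.map_swap ![w, v] (i := 0) (j := 1) (by decide)
  have hvec : ![w, v] ∘ Equiv.swap (0 : Fin 2) 1 = ![v, w] := by
    ext i
    fin_cases i <;> rfl
  rw [hvec] at h
  exact h

theorem fderiv_alternating_two {A : E → E [⋀^Fin 2]→L[ℝ] ℝ} {X Y : E → E} {y : E}
    (hA : DifferentiableAt ℝ A y) (hX : DifferentiableAt ℝ X y) (hY : DifferentiableAt ℝ Y y)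
    (u : E) :
    fderiv ℝ (fun z ↦ A z ![X z, Y z]) y u = fderiv ℝ A y u ![X y, Y y] +
      (A y ![fderiv ℝ X y u, Y y] + A y ![X y, fderiv ℝ Y y u]) := by
  have hvec : ∀ z : E, (fun i ↦ (![X, Y] : Fin 2 → E → E) i z) = ![X z, Y z] := fun z ↦ by
    ext i
    fin_cases i <;> rfl
  have h := fderiv_continuousAlternatingMap_apply_apply (g := ![X, Y]) hA
    (fun i ↦ by fin_cases i <;> assumption) u
  simp only [hvec, Fin.sum_univ_two] at h
  rw [h]
  congr 3
  · ext i; fin_cases i <;> rfl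
  · ext i; fin_cases i <;> rfl

/-- The alternating sum over the removed argument defining `extDeriv`, with no normalising factor.
-/
theorem extDeriv_two_apply {A : E → E [⋀^Fin 2]→L[ℝ] ℝ} {y : E} (hA : DifferentiableAt ℝ A y)
    (u v w : E) :
    extDeriv A y ![u, v, w] =
      fderiv ℝ A y u ![v, w] - fderiv ℝ A y v ![u, w] + fderiv ℝ A y w ![u, v] := by
  have hvec : ∀ (i : Fin 3), (i.removeNth ![u, v, w] : Fin 2 → E) =
      ![![v, w], ![u, w], ![u, v]] i := fun i ↦ by
    fin_cases i <;> (ext j; fin_cases j <;> rfl)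
  have hc : ∀ a b c : E, fderiv ℝ (fun z ↦ A z ![a, b]) y c = fderiv ℝ A y c ![a, b] := by
    intro a b c
    have h := fderiv_alternating_two hA (differentiableAt_const a) (differentiableAt_const b) c
    rw [h]
    have h0 : A y ![(0 : E), b] = 0 := (A y).map_coord_zero 0 rfl
    have h1 : A y ![a, (0 : E)] = 0 := (A y).map_coord_zero 1 rfl
    simp [h0, h1]
  rw [extDeriv_apply hA]
  refine (Fin.sum_univ_three _).trans ?_
  simp only [hvec]
  simp [hc]
  ring

/-- If `ι_X A = -df` and `ι_Y A = -dg` near a point where the `2`-form `A` is closed, then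
`ι_{[X, Y]} A = -d(A(X, Y))` at that point. -/
theorem closed_two_form_apply_lieBracket {A : E → E [⋀^Fin 2]→L[ℝ] ℝ} {X Y : E → E} {f g : E → ℝ}
    {y : E} (hA : DifferentiableAt ℝ A y) (hX : DifferentiableAt ℝ X y)
    (hY : DifferentiableAt ℝ Y y) (hf : ContDiffAt ℝ 2 f y) (hg : ContDiffAt ℝ 2 g y)
    (hclosed : extDeriv A y = 0)
    (hXf : ∀ᶠ z in 𝓝 y, ∀ w, A z ![X z, w] = -fderiv ℝ f z w)
    (hYg : ∀ᶠ z in 𝓝 y, ∀ w, A z ![Y z, w] = -fderiv ℝ g z w) (w : E) :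
    A y ![lieBracket ℝ X Y y, w] = -fderiv ℝ (fun z ↦ A z ![X z, Y z]) y w := by
  -- Differentiate `A(Z, v) = -dk(v)` in the direction `u` with `v` frozen, and solve for the term
  -- containing the derivative of `Z`.
  have key : ∀ {Z : E → E} {k : E → ℝ}, DifferentiableAt ℝ Z y → ContDiffAt ℝ 2 k y →
      (∀ᶠ z in 𝓝 y, ∀ w, A z ![Z z, w] = -fderiv ℝ k z w) → ∀ u v : E,
      A y ![fderiv ℝ Z y u, v] =
        -fderiv ℝ (fderiv ℝ k) y u v - fderiv ℝ A y u ![Z y, v] := by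
    intro Z k hZ hk hZk u v
    have hk' : DifferentiableAt ℝ (fderiv ℝ k) y :=
      (hk.fderiv_right (m := 1) (by norm_num)).differentiableAt one_ne_zero
    have h1 : (fun z ↦ A z ![Z z, v]) =ᶠ[𝓝 y] fun z ↦ -fderiv ℝ k z v :=
      hZk.mono fun z hz ↦ hz v
    have h2 := congrArg (fun T : E →L[ℝ] ℝ ↦ T u) h1.fderiv_eq
    simp only [fderiv_alternating_two hA hZ (differentiableAt_const v)] at h2
    have h3 : A y ![Z y, (0 : E)] = 0 := (A y).map_coord_zero 1 rfl
    have h4 : fderiv ℝ (fun z ↦ -fderiv ℝ k z v) y u = -fderiv ℝ (fderiv ℝ k) y u v := by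
      rw [fderiv_fun_neg, fderiv_clm_apply hk' (differentiableAt_const v)]
      simp
    rw [h4] at h2
    simp [h3] at h2
    linarith
  have symm : ∀ {k : E → ℝ}, ContDiffAt ℝ 2 k y → ∀ u v : E,
      fderiv ℝ (fderiv ℝ k) y u v = fderiv ℝ (fderiv ℝ k) y v u := fun hk u v ↦
    (hk.isSymmSndFDerivAt (by simp)).eq u v
  have hd := extDeriv_two_apply hA (X y) (Y y) w
  rw [hclosed, show (0 : E [⋀^Fin 3]→L[ℝ] ℝ) ![X y, Y y, w] = 0 from rfl] at hd
  have hsub : A y ![lieBracket ℝ X Y y, w] =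
      A y ![fderiv ℝ Y y (X y), w] - A y ![fderiv ℝ X y (Y y), w] := by
    simp [lieBracket_eq]
  rw [hsub, fderiv_alternating_two hA hX hY, alternating_two_swap (A y) (X y) (fderiv ℝ Y y w),
    key hY hg hYg, key hX hf hXf, key hX hf hXf, key hY hg hYg, symm hf, symm hg,
    alternating_two_swap (fderiv ℝ A y w) (Y y) (X y)]
  -- After the second derivatives of `f` and `g` cancel, the two sides differ by `dA(X, Y, w)` up to
  -- sign, which `hd` says is zero.
  linarith

end VectorSpace

/-! ### Transfer between the manifold and a chart. -/

section Chart

variable {E : Type*} [NormedAddCommGroup E] [NormedSpace ℝ E]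
  {M : Type*} [TopologicalSpace M] [ChartedSpace E M] [IsManifold 𝓘(ℝ, E) ∞ M]

theorem contDiffAt_comp_extChartAt_symm (f : SmoothFunction E M) (x₀ : M) {z : E}
    (hz : z ∈ (extChartAt 𝓘(ℝ, E) x₀).target) :
    ContDiffAt ℝ ∞ (f ∘ (extChartAt 𝓘(ℝ, E) x₀).symm) z := by
  have h : ContMDiffAt 𝓘(ℝ, E) 𝓘(ℝ, E) ∞ (extChartAt 𝓘(ℝ, E) x₀).symm z :=
    (contMDiffOn_extChartAt_symm x₀).contMDiffAt ((isOpen_extChartAt_target x₀).mem_nhds hz)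
  exact (f.contMDiff.contMDiffAt.comp z h).contDiffAt

theorem differential_mfderiv_extChartAt_symm (f : SmoothFunction E M) (x₀ : M) {z : E}
    (hz : z ∈ (extChartAt 𝓘(ℝ, E) x₀).target) (w : E) :
    differential f ((extChartAt 𝓘(ℝ, E) x₀).symm z)
        (mfderiv 𝓘(ℝ, E) 𝓘(ℝ, E) (extChartAt 𝓘(ℝ, E) x₀).symm z w) =
      fderiv ℝ (f ∘ (extChartAt 𝓘(ℝ, E) x₀).symm) z w := by
  have h : ContMDiffAt 𝓘(ℝ, E) 𝓘(ℝ, E) ∞ (extChartAt 𝓘(ℝ, E) x₀).symm z :=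
    (contMDiffOn_extChartAt_symm x₀).contMDiffAt ((isOpen_extChartAt_target x₀).mem_nhds hz)
  have hf : MDifferentiableAt 𝓘(ℝ, E) 𝓘(ℝ, ℝ) f ((extChartAt 𝓘(ℝ, E) x₀).symm z) :=
    f.contMDiff.contMDiffAt.mdifferentiableAt (by simp)
  rw [← mfderiv_eq_fderiv, mfderiv_comp z hf (h.mdifferentiableAt (by simp))]
  rfl

/-- The tangent space at `x₀` is the model space `E`, identified through the preferred chart at
`x₀`; hence that chart and its inverse have identity derivative at the centre. Thus pointwise
statements at `x₀` need no change of coordinates. -/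
theorem mfderiv_extChartAt_symm_self (x₀ : M) (w : E) :
    mfderiv 𝓘(ℝ, E) 𝓘(ℝ, E) (extChartAt 𝓘(ℝ, E) x₀).symm (extChartAt 𝓘(ℝ, E) x₀ x₀) w = w := by
  have : IsManifold 𝓘(ℝ, E) 1 M := IsManifold.of_le (n := ∞) (by simp)
  have h := mfderivWithin_extChartAt_symm_comp_mfderiv_extChartAt' (I := 𝓘(ℝ, E))
    (mem_extChartAt_source (I := 𝓘(ℝ, E)) x₀)
  rw [mfderiv_extChartAt_self] at h
  simp only [modelWithCornersSelf_coe, range_id, mfderivWithin_univ] at h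
  exact congrArg (fun T : E →L[ℝ] E ↦ T w) h

theorem differential_eq_fderiv (f : SmoothFunction E M) (x₀ : M) (w : E) :
    differential f x₀ w =
      fderiv ℝ (f ∘ (extChartAt 𝓘(ℝ, E) x₀).symm) (extChartAt 𝓘(ℝ, E) x₀ x₀) w := by
  rw [← differential_mfderiv_extChartAt_symm f x₀ (mem_extChartAt_target x₀),
    mfderiv_extChartAt_symm_self, extChartAt_to_inv]

theorem DifferentialForm.inChart_apply_two (α : DifferentialForm E M 2) (x₀ : M) (z v w : E) :
    α.inChart x₀ z ![v, w] =
      α.eval₂ ((extChartAt 𝓘(ℝ, E) x₀).symm z)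
        (mfderiv 𝓘(ℝ, E) 𝓘(ℝ, E) (extChartAt 𝓘(ℝ, E) x₀).symm z v)
        (mfderiv 𝓘(ℝ, E) 𝓘(ℝ, E) (extChartAt 𝓘(ℝ, E) x₀).symm z w) := by
  change α _ _ = α _ _
  congr 1
  funext i
  fin_cases i <;> rfl

theorem DifferentialForm.eval₂_eq_inChart (α : DifferentialForm E M 2) (x₀ : M) (v w : E) :
    α.eval₂ x₀ v w = α.inChart x₀ (extChartAt 𝓘(ℝ, E) x₀ x₀) ![v, w] := by
  rw [inChart_apply_two, mfderiv_extChartAt_symm_self, mfderiv_extChartAt_symm_self,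
    extChartAt_to_inv]

theorem DifferentialForm.extDeriv_inChart_self {k : ℕ} (α : DifferentialForm E M k) (x₀ : M) :
    extDeriv (α.inChart x₀) (extChartAt 𝓘(ℝ, E) x₀ x₀) = α.extDerivAt x₀ := by
  have : IsManifold 𝓘(ℝ, E) 1 M := IsManifold.of_le (n := ∞) (by simp)
  unfold DifferentialForm.extDerivAt
  rw [mfderiv_extChartAt_self]
  ext v
  rfl

/-- On the chart target the inverse trivialization of the tangent bundle is the derivative of the
inverse chart, so the chart expression is `coordForm` composed with the inverse chart, and
`coordForm` is smooth at `x₀`. -/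
theorem DifferentialForm.differentiableAt_inChart {k : ℕ} (α : DifferentialForm E M k) (x₀ : M) :
    DifferentiableAt ℝ (α.inChart x₀) (extChartAt 𝓘(ℝ, E) x₀ x₀) := by
  have : IsManifold 𝓘(ℝ, E) 1 M := IsManifold.of_le (n := ∞) (by simp)
  have hmem := (isOpen_extChartAt_target (I := 𝓘(ℝ, E)) x₀).mem_nhds (mem_extChartAt_target x₀)
  have h : ContMDiffAt 𝓘(ℝ, E) 𝓘(ℝ, E) ∞ (extChartAt 𝓘(ℝ, E) x₀).symm
      (extChartAt 𝓘(ℝ, E) x₀ x₀) :=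
    (contMDiffOn_extChartAt_symm x₀).contMDiffAt hmem
  have h2 := (contMDiffAt_coordForm α x₀)
  rw [← extChartAt_to_inv (I := 𝓘(ℝ, E)) x₀] at h2
  have h3 := (h2.comp _ h).contDiffAt.differentiableAt (by simp)
  refine (h3.congr_of_eventuallyEq ?_)
  filter_upwards [hmem] with z hz
  have hs := (extChartAt 𝓘(ℝ, E) x₀).map_target hz
  rw [extChartAt_source] at hs
  simp only [Function.comp_apply, coordForm, DifferentialForm.inChart, extChartAt_to_inv]
  rw [TangentBundle.symmL_trivializationAt (I := 𝓘(ℝ, E)) hs]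
  simp only [modelWithCornersSelf_coe, range_id, mfderivWithin_univ]
  rw [(extChartAt 𝓘(ℝ, E) x₀).right_inv hz]
  rfl

/-- The expression of a vector field in the chart around `x₀`. -/
def fieldInChart (X : SmoothVectorField E M) (x₀ : M) (z : E) : E :=
  mpullbackWithin 𝓘(ℝ, E) 𝓘(ℝ, E) (extChartAt 𝓘(ℝ, E) x₀).symm X (range 𝓘(ℝ, E)) z

/-- The derivative of the inverse chart is invertible on the whole target, so pushing the
pulled-back field forward recovers `X`. -/
theorem mfderiv_extChartAt_symm_fieldInChart (X : SmoothVectorField E M) (x₀ : M) {z : E}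
    (hz : z ∈ (extChartAt 𝓘(ℝ, E) x₀).target) :
    mfderiv 𝓘(ℝ, E) 𝓘(ℝ, E) (extChartAt 𝓘(ℝ, E) x₀).symm z
        (fieldInChart (E := E) X x₀ z) =
      X ((extChartAt 𝓘(ℝ, E) x₀).symm z) := by
  have : IsManifold 𝓘(ℝ, E) 1 M := IsManifold.of_le (n := ∞) (by simp)
  have h := isInvertible_mfderivWithin_extChartAt_symm hz
  unfold fieldInChart
  rw [mpullbackWithin_apply]
  simp only [modelWithCornersSelf_coe, range_id, mfderivWithin_univ] at h ⊢
  exact h.self_apply_inverse _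

theorem fieldInChart_self (X : SmoothVectorField E M) (x₀ : M) :
    fieldInChart X x₀ (extChartAt 𝓘(ℝ, E) x₀ x₀) = X x₀ := by
  have h := mfderiv_extChartAt_symm_fieldInChart X x₀ (mem_extChartAt_target x₀)
  rw [mfderiv_extChartAt_symm_self, extChartAt_to_inv] at h
  exact h

variable [FiniteDimensional ℝ E]

theorem differentiableAt_fieldInChart (X : SmoothVectorField E M) (x₀ : M) :
    DifferentiableAt ℝ (fieldInChart X x₀) (extChartAt 𝓘(ℝ, E) x₀ x₀) := by
  have : CompleteSpace E := FiniteDimensional.complete ℝ E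
  have : IsManifold 𝓘(ℝ, E) 2 M := IsManifold.of_le (n := ∞) (ENat.LEInfty.out)
  have h := MDifferentiableWithinAt.differentiableWithinAt_mpullbackWithin_vectorField
    (I := 𝓘(ℝ, E)) (s := univ) (V := X) (x := x₀)
    ((X.contMDiff x₀).mdifferentiableAt (by simp)).mdifferentiableWithinAt
  simp only [modelWithCornersSelf_coe, range_id, preimage_univ, univ_inter] at h
  rw [← differentiableWithinAt_univ]
  unfold fieldInChart
  simp only [modelWithCornersSelf_coe, range_id]
  exact h

/-- The manifold bracket is defined by pulling both fields back to the chart and transporting the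
result by the inverse of the chart derivative, which is the identity at the centre. -/
theorem vectorFieldBracket_eq_lieBracket (X Y : SmoothVectorField E M) (x₀ : M) :
    vectorFieldBracket X Y x₀ =
      lieBracket ℝ (fieldInChart X x₀) (fieldInChart Y x₀) (extChartAt 𝓘(ℝ, E) x₀ x₀) := by
  have : IsManifold 𝓘(ℝ, E) 1 M := IsManifold.of_le (n := ∞) (by simp)
  change mlieBracketWithin 𝓘(ℝ, E) X Y univ x₀ = _
  rw [mlieBracketWithin_apply, mfderiv_extChartAt_self]
  rw [← lieBracketWithin_univ]
  simp only [modelWithCornersSelf_coe, range_id, preimage_univ, univ_inter]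
  refine (congrArg (fun T : E →L[ℝ] E ↦ T _) ContinuousLinearMap.inverse_id).trans ?_
  unfold fieldInChart
  simp only [modelWithCornersSelf_coe, range_id]
  rfl

/-- Vector fields act on functions by derivations, and the Lie bracket acts as the commutator. -/
theorem differential_vectorFieldBracket (X Y : SmoothVectorField E M)
    (f fX fY : SmoothFunction E M) (hX : ∀ x, fX x = differential f x (X x))
    (hY : ∀ x, fY x = differential f x (Y x)) (x₀ : M) :
    differential f x₀ (vectorFieldBracket X Y x₀) =
      differential fY x₀ (X x₀) - differential fX x₀ (Y x₀) := by
  have hmem := (isOpen_extChartAt_target (I := 𝓘(ℝ, E)) x₀).mem_nhds (mem_extChartAt_target x₀)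
  have key : ∀ (Z : SmoothVectorField E M) (k : SmoothFunction E M),
      (∀ x, k x = differential f x (Z x)) →
      k ∘ (extChartAt 𝓘(ℝ, E) x₀).symm =ᶠ[𝓝 (extChartAt 𝓘(ℝ, E) x₀ x₀)] fun z ↦
        fderiv ℝ (f ∘ (extChartAt 𝓘(ℝ, E) x₀).symm) z (fieldInChart Z x₀ z) := by
    intro Z k hk
    filter_upwards [hmem] with z hz
    rw [← differential_mfderiv_extChartAt_symm f x₀ hz,
      mfderiv_extChartAt_symm_fieldInChart Z x₀ hz]
    exact hk _
  have h := fderiv_apply_lieBracket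
    (contDiffAt_comp_extChartAt_symm f x₀ (mem_extChartAt_target x₀))
    (by rw [minSmoothness_of_isRCLikeNormedField]; exact ENat.LEInfty.out)
    (differentiableAt_fieldInChart Y x₀) (differentiableAt_fieldInChart X x₀)
  rw [← (key X fX hX).fderiv_eq, ← (key Y fY hY).fderiv_eq, fieldInChart_self,
    fieldInChart_self] at h
  rw [vectorFieldBracket_eq_lieBracket]
  refine (differential_eq_fderiv f x₀ _).trans (h.trans ?_)
  exact congrArg₂ _ (differential_eq_fderiv fY x₀ _).symm (differential_eq_fderiv fX x₀ _).symm

/-- Only the value at the centre `x₀` of each chart is needed, but the Hamiltonian equations are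
differentiated there, so they are transferred to a whole neighbourhood. -/
theorem SymplecticForm.isHamiltonianFieldOf_vectorFieldBracket (σ : SymplecticForm E M)
    {f g : SmoothFunction E M} {X Y : SmoothVectorField E M} (hX : IsHamiltonianFieldOf σ f X)
    (hY : IsHamiltonianFieldOf σ g Y) :
    IsHamiltonianFieldOf σ (σ.form.evalFields X Y) (vectorFieldBracket X Y) := by
  intro x₀ w
  have hmem := (isOpen_extChartAt_target (I := 𝓘(ℝ, E)) x₀).mem_nhds (mem_extChartAt_target x₀)
  have key : ∀ (Z : SmoothVectorField E M) (k : SmoothFunction E M), IsHamiltonianFieldOf σ k Z →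
      ∀ᶠ z in 𝓝 (extChartAt 𝓘(ℝ, E) x₀ x₀), ∀ w,
        σ.form.inChart x₀ z ![fieldInChart Z x₀ z, w] =
          -fderiv ℝ (k ∘ (extChartAt 𝓘(ℝ, E) x₀).symm) z w := by
    intro Z k hk
    filter_upwards [hmem] with z hz w
    rw [← differential_mfderiv_extChartAt_symm k x₀ hz, DifferentialForm.inChart_apply_two,
      mfderiv_extChartAt_symm_fieldInChart Z x₀ hz]
    exact hk _ _
  have hsm : ∀ k : SmoothFunction E M,
      ContDiffAt ℝ 2 (k ∘ (extChartAt 𝓘(ℝ, E) x₀).symm) (extChartAt 𝓘(ℝ, E) x₀ x₀) := fun k ↦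
    (contDiffAt_comp_extChartAt_symm k x₀ (mem_extChartAt_target x₀)).of_le ENat.LEInfty.out
  have h := closed_two_form_apply_lieBracket (σ.form.differentiableAt_inChart x₀)
    (differentiableAt_fieldInChart X x₀) (differentiableAt_fieldInChart Y x₀) (hsm f) (hsm g)
    ((σ.form.extDeriv_inChart_self x₀).trans (σ.closed x₀)) (key X f hX) (key Y g hY) w
  have heval : σ.form.evalFields X Y ∘ (extChartAt 𝓘(ℝ, E) x₀).symm
      =ᶠ[𝓝 (extChartAt 𝓘(ℝ, E) x₀ x₀)] fun z ↦
        σ.form.inChart x₀ z ![fieldInChart X x₀ z, fieldInChart Y x₀ z] := by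
    filter_upwards [hmem] with z hz
    rw [DifferentialForm.inChart_apply_two, mfderiv_extChartAt_symm_fieldInChart X x₀ hz,
      mfderiv_extChartAt_symm_fieldInChart Y x₀ hz]
    rfl
  rw [← heval.fderiv_eq] at h
  rw [vectorFieldBracket_eq_lieBracket]
  refine (DifferentialForm.eval₂_eq_inChart (E := E) σ.form x₀ _ w).trans (h.trans ?_)
  exact congrArg Neg.neg (differential_eq_fderiv (E := E) _ x₀ w).symm

omit [FiniteDimensional ℝ E] in
theorem isLocallyConstant_iff_differential_eq_zero (f : SmoothFunction E M) :
    IsLocallyConstant f ↔ ∀ x, differential f x = 0 := by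
  constructor
  · intro h x
    have h1 : (f : M → ℝ) =ᶠ[𝓝 x] fun _ ↦ f x := (h.eventually_eq x)
    exact h1.mfderiv_eq.trans (mfderiv_const)
  · intro h
    rw [IsLocallyConstant.iff_eventually_eq]
    intro x₀
    have hmem := (isOpen_extChartAt_target (I := 𝓘(ℝ, E)) x₀)
    have hd : ∀ z ∈ (extChartAt 𝓘(ℝ, E) x₀).target,
        fderiv ℝ (f ∘ (extChartAt 𝓘(ℝ, E) x₀).symm) z = 0 := by
      intro z hz
      ext w
      rw [← differential_mfderiv_extChartAt_symm f x₀ hz, h]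
      rfl
    -- A function with zero derivative on an open set has open level sets, so the target need not be
    -- connected.
    have ho := hmem.isOpen_inter_preimage_of_fderiv_eq_zero
      (f := f ∘ (extChartAt 𝓘(ℝ, E) x₀).symm)
      (fun z hz ↦ ((contDiffAt_comp_extChartAt_symm f x₀ hz).differentiableAt
        (by simp)).differentiableWithinAt) hd {f x₀}
    have hx : extChartAt 𝓘(ℝ, E) x₀ x₀ ∈ (extChartAt 𝓘(ℝ, E) x₀).target ∩
        f ∘ (extChartAt 𝓘(ℝ, E) x₀).symm ⁻¹' {f x₀} := by
      refine ⟨mem_extChartAt_target x₀, ?_⟩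
      simp
    filter_upwards [(continuousAt_extChartAt x₀).preimage_mem_nhds (ho.mem_nhds hx),
      extChartAt_source_mem_nhds (I := 𝓘(ℝ, E)) x₀] with y hy hys
    have h' : f ((extChartAt 𝓘(ℝ, E) x₀).symm (extChartAt 𝓘(ℝ, E) x₀ y)) = f x₀ := hy.2
    rwa [(extChartAt 𝓘(ℝ, E) x₀).left_inv hys] at h'

end Chart

/-! ### Hamiltonian vector fields and the Poisson algebra. -/

section Poisson

variable {E : Type*} [NormedAddCommGroup E] [NormedSpace ℝ E]
  {M : Type*} [TopologicalSpace M] [ChartedSpace E M]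

theorem differential_add (f g : SmoothFunction E M) (x : M) :
    differential (f + g) x = differential f x + differential g x :=
  mfderiv_add (f.contMDiff.contMDiffAt.mdifferentiableAt (by simp))
    (g.contMDiff.contMDiffAt.mdifferentiableAt (by simp))

theorem differential_smul (c : ℝ) (f : SmoothFunction E M) (x : M) :
    differential (c • f) x = c • differential f x :=
  const_smul_mfderiv (f.contMDiff.contMDiffAt.mdifferentiableAt (by simp)) c

variable [IsManifold 𝓘(ℝ, E) ∞ M]

theorem DifferentialForm.eval₂_add_left (α : DifferentialForm E M 2) (x : M)
    (u v w : TangentSpace 𝓘(ℝ, E) x) : α.eval₂ x (u + v) w = α.eval₂ x u w + α.eval₂ x v w :=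
  alternating_two_add_left (E := E) (α x) u v w

theorem DifferentialForm.eval₂_smul_left (α : DifferentialForm E M 2) (x : M) (c : ℝ)
    (v w : TangentSpace 𝓘(ℝ, E) x) : α.eval₂ x (c • v) w = c * α.eval₂ x v w :=
  alternating_two_smul_left (E := E) (α x) c v w

theorem DifferentialForm.eval₂_swap (α : DifferentialForm E M 2) (x : M)
    (v w : TangentSpace 𝓘(ℝ, E) x) : α.eval₂ x v w = -α.eval₂ x w v :=
  alternating_two_swap (E := E) (α x) v w

theorem IsHamiltonianFieldOf.add {σ : SymplecticForm E M} {f g : SmoothFunction E M}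
    {V W : SmoothVectorField E M} (hV : IsHamiltonianFieldOf σ f V)
    (hW : IsHamiltonianFieldOf σ g W) : IsHamiltonianFieldOf σ (f + g) (V + W) := by
  intro x w
  have h := σ.form.eval₂_add_left x (V x) (W x) w
  rw [hV x w, hW x w] at h
  rw [differential_add]
  exact h.trans (neg_add _ _).symm

theorem IsHamiltonianFieldOf.smul {σ : SymplecticForm E M} {f : SmoothFunction E M}
    {V : SmoothVectorField E M} (hV : IsHamiltonianFieldOf σ f V) (c : ℝ) :
    IsHamiltonianFieldOf σ (c • f) (c • V) := by
  intro x w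
  have h := σ.form.eval₂_smul_left x c (V x) w
  rw [hV x w] at h
  rw [differential_smul]
  exact h.trans (mul_neg _ _)

variable [FiniteDimensional ℝ E] (σ : SymplecticForm E M)

/-- The field `v_f` is obtained by choice, so every identity about it goes through uniqueness: both
sides solve the same equation. -/
theorem isLinearMap_hamiltonianVectorField : IsLinearMap ℝ (hamiltonianVectorField σ) where
  map_add f g := (isHamiltonianFieldOf_hamiltonianVectorField σ (f + g)).unique
    ((isHamiltonianFieldOf_hamiltonianVectorField σ f).add
      (isHamiltonianFieldOf_hamiltonianVectorField σ g))
  map_smul c f := (isHamiltonianFieldOf_hamiltonianVectorField σ (c • f)).unique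
    ((isHamiltonianFieldOf_hamiltonianVectorField σ f).smul c)

theorem hamiltonianVectorField_poissonBracket (f g : SmoothFunction E M) :
    hamiltonianVectorField σ (poissonBracket σ f g) =
      vectorFieldBracket (hamiltonianVectorField σ f) (hamiltonianVectorField σ g) :=
  (isHamiltonianFieldOf_hamiltonianVectorField σ _).unique
    (σ.isHamiltonianFieldOf_vectorFieldBracket (isHamiltonianFieldOf_hamiltonianVectorField σ f)
      (isHamiltonianFieldOf_hamiltonianVectorField σ g))

theorem hamiltonianVectorField_eq_zero_iff (f : SmoothFunction E M) :
    hamiltonianVectorField σ f = 0 ↔ IsLocallyConstant f := by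
  rw [isLocallyConstant_iff_differential_eq_zero]
  have hz : ∀ (x : M) (w : TangentSpace 𝓘(ℝ, E) x), σ.form.eval₂ x 0 w = 0 := fun x w ↦ by
    simpa using σ.form.eval₂_smul_left x 0 0 w
  constructor
  · intro h x
    ext w
    have h' := isHamiltonianFieldOf_hamiltonianVectorField σ f x w
    rw [h] at h'
    exact neg_eq_zero.1 (h'.symm.trans (hz x w))
  · intro h
    refine (isHamiltonianFieldOf_hamiltonianVectorField σ f).unique fun x w ↦ ?_
    rw [h x]
    exact (hz x w).trans neg_zero.symm

theorem exists_hamiltonianVectorField_eq_iff (V : SmoothVectorField E M) :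
    (∃ f, hamiltonianVectorField σ f = V) ↔ ∃ f, IsHamiltonianFieldOf σ f V :=
  exists_congr fun f ↦ ⟨fun h ↦ h ▸ isHamiltonianFieldOf_hamiltonianVectorField σ f,
    (isHamiltonianFieldOf_hamiltonianVectorField σ f).unique⟩

theorem poissonBracket_swap (f g : SmoothFunction E M) :
    poissonBracket σ f g = -poissonBracket σ g f := by
  ext x
  exact σ.form.eval₂_swap x _ _

/-- With the bracket read as `v_f` acting on `g`, linearity in `g` reduces to that of the
differential. -/
theorem poissonBracket_apply (f g : SmoothFunction E M) (x : M) :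
    poissonBracket σ f g x = differential g x (hamiltonianVectorField σ f x) := by
  rw [poissonBracket_swap]
  have h := isHamiltonianFieldOf_hamiltonianVectorField σ g x (hamiltonianVectorField σ f x)
  exact neg_eq_iff_eq_neg.2 h

theorem poissonBracket_add_right (f g h : SmoothFunction E M) :
    poissonBracket σ f (g + h) = poissonBracket σ f g + poissonBracket σ f h := by
  ext x
  have h' := poissonBracket_apply σ f (g + h) x
  rw [differential_add] at h'
  exact h'.trans (congrArg₂ _ (poissonBracket_apply σ f g x) (poissonBracket_apply σ f h x)).symm

theorem poissonBracket_smul_right (c : ℝ) (f g : SmoothFunction E M) :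
    poissonBracket σ f (c • g) = c • poissonBracket σ f g := by
  ext x
  have h' := poissonBracket_apply σ f (c • g) x
  rw [differential_smul] at h'
  exact h'.trans (congrArg (c * ·) (poissonBracket_apply σ f g x)).symm

/-- The Jacobi identity in derivation form: `v_{f,g} = [v_f,v_g]` acts on `h` as the commutator of
`{f,·}` and `{g,·}`. -/
theorem poissonBracket_leibniz (f g h : SmoothFunction E M) :
    poissonBracket σ (poissonBracket σ f g) h =
      poissonBracket σ f (poissonBracket σ g h) - poissonBracket σ g (poissonBracket σ f h) := by
  ext x
  have key := differential_vectorFieldBracket (hamiltonianVectorField σ f)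
    (hamiltonianVectorField σ g) h (poissonBracket σ f h) (poissonBracket σ g h)
    (poissonBracket_apply σ f h) (poissonBracket_apply σ g h) x
  rw [← hamiltonianVectorField_poissonBracket, ← poissonBracket_apply, ← poissonBracket_apply,
    ← poissonBracket_apply] at key
  exact key

theorem isLieBracket_poissonBracket : IsLieBracket ℝ (poissonBracket σ) where
  add_left f g h := by
    rw [poissonBracket_swap, poissonBracket_add_right, neg_add, ← poissonBracket_swap,
      ← poissonBracket_swap]
  smul_left c f g := by
    rw [poissonBracket_swap, poissonBracket_smul_right, ← smul_neg, ← poissonBracket_swap]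
  add_right := poissonBracket_add_right σ
  smul_right c f g := poissonBracket_smul_right σ c f g
  self_eq_zero f := by
    ext x
    -- A real number equal to its own negative is zero.
    exact self_eq_neg.1 (σ.form.eval₂_swap x _ _)
  antisymm := poissonBracket_swap σ
  jacobi f g h := by
    have hneg : ∀ k l : SmoothFunction E M, poissonBracket σ k (-l) = -poissonBracket σ k l :=
      fun k l ↦ by simpa using poissonBracket_smul_right σ (-1) k l
    -- Writing `{h,{f,g}}` as `-{{f,g},h}` and expanding by the derivation form leaves terms that
    -- cancel once `{h,f} = -{f,h}`.
    rw [poissonBracket_swap σ h (poissonBracket σ f g), poissonBracket_leibniz,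
      poissonBracket_swap σ h f, hneg]
    abel

end Poisson

end SymplecticGeometry

end


theorem mainTheorem2
    {E : Type*} [NormedAddCommGroup E] [NormedSpace ℝ E] [FiniteDimensional ℝ E]
    {M : Type*} [TopologicalSpace M] [ChartedSpace E M] [IsManifold 𝓘(ℝ, E) ∞ M]
    (σ : SymplecticGeometry.SymplecticForm E M) :
    -- the Poisson bracket makes `C^∞(M)` a real Lie algebra
    SymplecticGeometry.IsLieBracket ℝ (SymplecticGeometry.poissonBracket σ) ∧
    -- `f ↦ v_f` is a homomorphism of Lie algebras from `C^∞(M)` to `𝔛(M)`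
    IsLinearMap ℝ (SymplecticGeometry.hamiltonianVectorField σ) ∧
    (∀ f g : SymplecticGeometry.SmoothFunction E M,
      SymplecticGeometry.hamiltonianVectorField σ (SymplecticGeometry.poissonBracket σ f g) =
        SymplecticGeometry.vectorFieldBracket
          (SymplecticGeometry.hamiltonianVectorField σ f)
          (SymplecticGeometry.hamiltonianVectorField σ g)) ∧
    -- its kernel consists of the locally constant functions
    (∀ f : SymplecticGeometry.SmoothFunction E M,
      SymplecticGeometry.hamiltonianVectorField σ f = 0 ↔ IsLocallyConstant f) ∧
    -- its image is the space of Hamiltonian vector fields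
    (∀ V : SymplecticGeometry.SmoothVectorField E M,
      (∃ f, SymplecticGeometry.hamiltonianVectorField σ f = V) ↔
        ∃ f, SymplecticGeometry.IsHamiltonianFieldOf σ f V) := by
  exact ⟨SymplecticGeometry.isLieBracket_poissonBracket σ,
    SymplecticGeometry.isLinearMap_hamiltonianVectorField σ,
    SymplecticGeometry.hamiltonianVectorField_poissonBracket σ,
    SymplecticGeometry.hamiltonianVectorField_eq_zero_iff σ,
    SymplecticGeometry.exists_hamiltonianVectorField_eq_iff σ⟩
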